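/- Let $q$ be a prime power. For linear codes over $\mathbb F_q$, an $[n,k,d]_q$ code is a $k$-dimensional subspace of $\mathbb F_q^n$ with minimum Hamming distance $d$. Such a code $\mathcal C$ is an $(r,\delta)$-LRC if every coordinate $i$ lies in a set $S_i$ of at most $r+\delta-1$ coordinates such that the punctured code $\mathcal C|_{S_i}$ has minimum distance at least $\delta$; it is optimal if moreover $d=n-k+1-\left(\lceil k/r\rceil-1\right)(\delta-1)$. An $M\times N$ matrix is nonsingular by columns (NSC) if, for every $1\le i\le M$, every $i\times i$ submatrix of its first $i$ rows is nonsingular. For codes $\mathcal C_1,\dots,\mathcal C_M\subseteq\mathbb F_q^n$ and $A=(a_{\ell,j})\in\mathbb F_q^{M\times N}$, the matrix-product code $(\mathcal C_1,\dots,\mathcal C_M)\cdot A$ consists of all words $\left(\sum_\ell a_{\ell,1}\mathbf c_\ell,\dots,\sum_\ell a_{\ell,N}\mathbf c_\ell\right)$ with $\mathbf c_\ell\in\mathcal C_\ell$. Let $\alpha$ be a primitive $(q+1)$-th root of unity in an extension field of $\mathbb F_q$ and let $b\in\mathbb F_q^*$. For odd $k\le q$, let $\mathcal C^{q+1}_k$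 be the cyclic or constacyclic code of length $q+1$ with constant $b^2$ whose zeros are the $q+1-k$ elements $b\alpha^j$, $\frac{k+1}{2}\le j\le q+1-\frac{k+1}{2}$; that is, $\mathcal C^{q+1}_k=\{(c_0,\dots,c_q)\in\mathbb F_q^{q+1}:\sum_i c_i z^i=0\text{ for all these }z\}$. (a) Let $M,N,r$ be integers with $q\ge N>M>1$, $r\ge 1$ odd and $(r-1)(N-M+1)+r\le q+2$, and let $A$ be an $M\times N$ NSC matrix over $\mathbb F_q$. Then $\mathcal C^{q+1}_1\subseteq\mathcal C^{q+1}_r$ are nested MDS codes with parameters $[q+1,1,q+1]_q$ and $[q+1,r,q+2-r]_q$. With $\mathcal C_1=\cdots=\mathcal C_{M-1}=\mathcal C^{q+1}_r$ and $\mathcal C_M=\mathcal C^{q+1}_1$, the matrix-product code $(\mathcal C_1,\dots,\mathcal C_M)\cdot A$ is an optimal $(r,q+2-r)$-LRC with parameters $$[N(q+1),\,(M-1)r+1,\,(N-M+1)(q+1)]_q .$$ Its length is at most $q^2+q$. (b) The length $q^2+q$ is attained: for all integers $M,r$ with $1<M<q$, $r\ge 1$ odd and $(r-1)(q-M+1)+r\le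 q+2$, there is an $M\times q$ NSC matrix $A$ over $\mathbb F_q$, for which the code of (a) with $N=q$ is an optimal $(r,q+2-r)$-LRC with parameters $[q^2+q,(M-1)r+1,(q-M+1)(q+1)]_q$. -/

import Mathlib

noncomputable section

namespace LRC

open scoped Classical in
/-- Minimum Hamming distance between distinct words of a linear code (`⊤` if the code is zero). -/
def minDist {F ι : Type*} [Field F] [Fintype ι] (C : Submodule F (ι → F)) : ℕ∞ :=
  ⨅ x ∈ C, ⨅ y ∈ C, ⨅ _ : x ≠ y, (hammingDist x y : ℕ∞)

/-- `C` is an `[n, k, d]` code. -/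
def HasParams {F ι : Type*} [Field F] [Fintype ι] (C : Submodule F (ι → F)) (n k d : ℕ) : Prop :=
  Fintype.card ι = n ∧ Module.finrank F C = k ∧ minDist C = (d : ℕ∞)

/-- The punctured code `C|_S`: only the coordinates in `S` are kept. -/
def puncture {F ι : Type*} [Field F] (C : Submodule F (ι → F)) (S : Finset ι) :
    Submodule F (S → F) :=
  C.map (LinearMap.funLeft F F (Subtype.val : S → ι))

/-- The symbol `i` of `C` has `(r, δ)`-locality. -/
def HasLocality {F ι : Type*} [Field F] [Fintype ι] (C : Submodule F (ι → F)) (r δ : ℕ)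
    (i : ι) : Prop :=
  ∃ S : Finset ι, i ∈ S ∧ S.card ≤ r + δ - 1 ∧ (δ : ℕ∞) ≤ minDist (puncture C S)

/-- `C` is an `(r, δ)`-LRC: all symbols have `(r, δ)`-locality. -/
def IsLRC {F ι : Type*} [Field F] [Fintype ι] (C : Submodule F (ι → F)) (r δ : ℕ) : Prop :=
  ∀ i, HasLocality C r δ i

/-- An `(r, δ)`-LRC is optimal if it attains the Singleton-type bound
`d ≤ n - k + 1 - (⌈k / r⌉ - 1) (δ - 1)`, computed in `ℤ`. -/
def IsOptimalLRC {F ι : Type*} [Field F] [Fintype ι] (C : Submodule F (ι → F)) (r δ : ℕ) : Prop :=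
  IsLRC C r δ ∧ ∃ n k d : ℕ, HasParams C n k d ∧
    (d : ℤ) = n - k + 1 - (⌈(k : ℚ) / (r : ℚ)⌉ - 1) * ((δ : ℤ) - 1)

/-- The matrix-product code `(C₁, …, C_M) · A`. A word of length `N n` is indexed by
`Fin N × Fin n`: block number, then position in the block. -/
def matrixProductCode {F : Type*} [Field F] {M N n : ℕ} (C : Fin M → Submodule F (Fin n → F))
    (A : Matrix (Fin M) (Fin N) F) : Submodule F (Fin N × Fin n → F) where
  carrier := {x | ∃ c : Fin M → Fin n → F, (∀ l, c l ∈ C l) ∧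
    x = fun p => ∑ l, c l p.2 * A l p.1}
  zero_mem' := ⟨0, fun l => (C l).zero_mem, by ext p; simp⟩
  add_mem' := by
    rintro _ _ ⟨c, hc, rfl⟩ ⟨c', hc', rfl⟩
    refine ⟨c + c', fun l => (C l).add_mem (hc l) (hc' l), ?_⟩
    ext p
    simp [add_mul, Finset.sum_add_distrib]
  smul_mem' := by
    rintro a _ ⟨c, hc, rfl⟩
    refine ⟨a • c, fun l => (C l).smul_mem a (hc l), ?_⟩
    ext p
    simp [Finset.mul_sum, mul_assoc]

/-- Nonsingular by columns: for every `i ≤ M`, every choice of `i` columns of the first `i` rows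
gives a nonsingular `i × i` matrix. -/
def NSC {F : Type*} [Field F] {M N : ℕ} (A : Matrix (Fin M) (Fin N) F) : Prop :=
  ∀ (i : ℕ) (hi : i ≤ M) (J : Fin i ↪o Fin N), (A.submatrix (Fin.castLE hi) J).det ≠ 0

/-- The code of length `n` over `F` with zeros `Z`, a set in an extension field `K`: all
`c ∈ F ^ n` whose polynomial `∑ cᵢ Xⁱ` vanishes on `Z`. If `Z` consists of roots of `X ^ n - t`
with `t ∈ F` nonzero, it is `t`-constacyclic (cyclic if `t = 1`), and every constacyclic code with
`n` prime to the characteristic is of this form for a large enough `K`. -/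
def codeWithZeros (F : Type*) {K : Type*} [Field F] [Field K] [Algebra F K] (n : ℕ) (Z : Set K) :
    Submodule F (Fin n → F) where
  carrier := {c | ∀ z ∈ Z, ∑ i, algebraMap F K (c i) * z ^ (i : ℕ) = 0}
  zero_mem' := by intro z _; simp
  add_mem' := by
    intro c c' hc hc' z hz
    simp [add_mul, Finset.sum_add_distrib, hc z hz, hc' z hz]
  smul_mem' := by
    intro a c hc z hz
    simp [mul_assoc, ← Finset.mul_sum, hc z hz]

/-- For odd `k ≤ q`, `b ∈ F` nonzero and `α` a primitive `(q + 1)`-th root of unity, the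
`b ^ 2`-constacyclic code of length `q + 1` with the `q + 1 - k` consecutive zeros
`b α ^ j`, `(k + 1) / 2 ≤ j ≤ q + 1 - (k + 1) / 2` (equivalently, with the nonzeros `b α ^ j`,
`|j| ≤ (k - 1) / 2`). It is cyclic when `b = 1` or `b = -1`. -/
def oddMDSCode {F K : Type*} [Field F] [Field K] [Algebra F K] (q : ℕ) (α : K) (b : Fˣ) (k : ℕ) :
    Submodule F (Fin (q + 1) → F) :=
  codeWithZeros F (q + 1)
    {z | ∃ j : ℕ, k + 1 ≤ 2 * j ∧ 2 * j + (k + 1) ≤ 2 * (q + 1) ∧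
      z = algebraMap F K (b : F) * α ^ j}

/-- The `M` constituent codes `C, …, C, D`. -/
def constituents {F ι : Type*} [Field F] (M : ℕ) (C D : Submodule F (ι → F)) :
    Fin M → Submodule F (ι → F) :=
  fun l => if (l : ℕ) + 1 < M then C else D

end LRC

end

/-! Each constituent code is MDS. Its `q + 1 - k` zeros are consecutive, so the BCH bound gives
weight at least `q + 2 - k`. Frobenius sends `b α ^ j` to `b α ^ (q + 1 - j)`, so the zero set is
stable and the generator polynomial descends to `F`. Its multiples give dimension at least `k`, and
Singleton gives the rest.

For the product, let `l` (counted from 0) be the last index with `c l ≠ 0`. NSC lets the combination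
vanish in at most `l` blocks at each position of the support of `c l`, so the weight is at least `(N
- l)` times that of `c l` (`NSC.mul_hammingNorm_le`). Hence `d` is at least the minimum of `(N - M +
2)(q + 2 - r)` and `(N - M + 1)(q + 1)`. The numerical hypothesis says exactly that the second is
the smaller, and `NSC.exists_hammingNorm_le` attains it. Every block is a word of the larger code,
which gives locality. For (b), a Vandermonde matrix on all of `F` has `q` columns. -/

namespace LRC

open Polynomial Finset

/-! ### Minimum distance and the Singleton bound. -/

section MinDist

variable {F ι : Type*} [Field F] [Fintype ι] [DecidableEq F]

/-- Replaces the classical decidability instance inside `minDist` by the ambient one. -/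
theorem minDist_eq_iInf_hammingDist (C : Submodule F (ι → F)) :
    minDist C = ⨅ x ∈ C, ⨅ y ∈ C, ⨅ _ : x ≠ y, (hammingDist x y : ℕ∞) := by
  unfold minDist
  congr! with x _ y _ hxy

theorem le_minDist_iff (C : Submodule F (ι → F)) (d : ℕ) :
    (d : ℕ∞) ≤ minDist C ↔ ∀ x ∈ C, x ≠ 0 → d ≤ hammingNorm x := by
  rw [minDist_eq_iInf_hammingDist]
  simp only [le_iInf_iff, Nat.cast_le]
  constructor
  · intro h x hx hx0
    simpa using h x hx 0 C.zero_mem hx0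
  · intro h x hx y hy hxy
    rw [hammingDist_eq_hammingNorm]
    exact h _ (C.add_mem (C.neg_mem hx) hy) (by rwa [ne_eq, neg_add_eq_zero])

theorem minDist_eq_of_hammingNorm {C : Submodule F (ι → F)} {d : ℕ}
    (h : ∀ x ∈ C, x ≠ 0 → d ≤ hammingNorm x) (h' : ∃ x ∈ C, x ≠ 0 ∧ hammingNorm x ≤ d) :
    minDist C = d := by
  refine le_antisymm ?_ ((le_minDist_iff C d).2 h)
  obtain ⟨x, hx, hx0, hd⟩ := h'
  rw [minDist_eq_iInf_hammingDist]
  refine (iInf₂_le_of_le x hx <| iInf₂_le_of_le 0 C.zero_mem <| iInf_le _ hx0).trans ?_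
  simpa using hd

/-- The Singleton bound. -/
theorem finrank_le_of_hammingNorm {n k : ℕ} (hk : k ≤ n) {C : Submodule F (Fin n → F)}
    (h : ∀ x ∈ C, x ≠ 0 → n + 1 - k ≤ hammingNorm x) : Module.finrank F C ≤ k := by
  -- A word vanishing on the first `k` coordinates has weight at most `n - k`, hence is zero.
  let f : C →ₗ[F] (Fin k → F) := (LinearMap.funLeft F F (Fin.castLE hk)).comp C.subtype
  have hf : Function.Injective f := by
    rw [← LinearMap.ker_eq_bot, LinearMap.ker_eq_bot']
    intro x hx
    by_contra hx0
    have h1 := h x x.2 (by simpa using hx0)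
    have h2 : hammingNorm (x : Fin n → F) ≤ #((univ.image (Fin.castLE hk))ᶜ) := by
      refine card_le_card fun i hi => ?_
      simp only [mem_filter, mem_univ, true_and, mem_compl, mem_image, not_exists] at hi ⊢
      rintro j rfl
      exact hi (congrFun hx j)
    rw [card_compl, card_image_of_injective _ (Fin.castLE_injective hk)] at h2
    simp only [Fintype.card_fin, card_univ] at h2
    omega
  simpa using LinearMap.finrank_le_finrank_of_injective hf

end MinDist

/-! ### The BCH bound and descent to the base field. -/

/-- The BCH bound: a word with `s` consecutive zeros has weight more than `s`. -/
theorem lt_hammingNorm_of_consecutive_zeros {F K : Type*} [Field F] [Field K] [Algebra F K]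
    [DecidableEq F] {n s j₀ : ℕ} {α β : K} (hα : IsPrimitiveRoot α n) (hα0 : α ≠ 0) (hβ : β ≠ 0)
    {c : Fin n → F} (hc : c ≠ 0)
    (h : ∀ t < s, ∑ i, algebraMap F K (c i) * (β * α ^ (j₀ + t)) ^ (i : ℕ) = 0) :
    s < hammingNorm c := by
  classical
  by_contra! hs
  obtain ⟨i₀, hi₀⟩ := Function.ne_iff.1 hc
  set T : Finset (Fin n) := univ.filter (fun i => c i ≠ 0) with hT
  have hi₀T : i₀ ∈ T := by simpa [hT] using hi₀
  have hTs : #T ≤ s := hs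
  set y : Fin n → K := fun i => algebraMap F K (c i) * (β * α ^ j₀) ^ (i : ℕ) with hy
  have hzero : ∀ t < s, ∑ i, y i * (α ^ (i : ℕ)) ^ t = 0 := by
    intro t ht
    rw [← h t ht]
    refine sum_congr rfl fun i _ => ?_
    simp only [hy]
    ring
  -- `P` vanishes at every support node except that of `i₀` and has degree below `s`, so the
  -- vanishing power sums `hzero` isolate the single term at `i₀`.
  set P : K[X] := ∏ i ∈ T.erase i₀, (X - C (α ^ (i : ℕ))) with hP
  have hdeg : P.natDegree < s := by
    rw [hP, natDegree_finsetProd_X_sub_C_eq_card, card_erase_of_mem hi₀T]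
    have := card_pos.2 ⟨_, hi₀T⟩
    omega
  have hsum : ∑ i, y i * P.eval (α ^ (i : ℕ)) = 0 := by
    simp_rw [eval_eq_sum_range' hdeg, mul_sum]
    rw [sum_comm]
    refine sum_eq_zero fun t ht => ?_
    have := hzero t (mem_range.1 ht)
    calc ∑ i, y i * (P.coeff t * (α ^ (i : ℕ)) ^ t)
        = P.coeff t * ∑ i, y i * (α ^ (i : ℕ)) ^ t := by
          rw [mul_sum]; exact sum_congr rfl fun i _ => by ring
      _ = 0 := by rw [this, mul_zero]
  rw [sum_eq_single i₀] at hsum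
  · rcases mul_eq_zero.1 hsum with h0 | h0
    · simp only [hy, mul_eq_zero, pow_eq_zero_iff', map_eq_zero] at h0
      rcases h0 with h0 | ⟨h0 | h0, -⟩
      · exact hi₀ h0
      · exact hβ h0
      · exact hα0 h0.1
    · rw [hP, eval_prod, prod_eq_zero_iff] at h0
      obtain ⟨i, hi, h0⟩ := h0
      simp only [eval_sub, eval_X, eval_C, sub_eq_zero] at h0
      exact (mem_erase.1 hi).1 (Fin.ext (hα.pow_inj i.2 i₀.2 h0.symm))
  · intro i _ hi
    by_cases hiT : i ∈ T
    · have : P.eval (α ^ (i : ℕ)) = 0 := by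
        rw [hP, eval_prod]
        exact prod_eq_zero (mem_erase.2 ⟨hi, hiT⟩) (by simp)
      rw [this, mul_zero]
    · have : c i = 0 := by simpa [hT] using hiT
      simp [hy, this]
  · simp

/-- `X ^ q - X` has at most `q` roots in `K`, and the image of `F` already supplies `q`. -/
theorem mem_range_algebraMap_of_pow_card_eq {F K : Type*} [Field F] [Fintype F] [Field K]
    [Algebra F K] {x : K} (hx : x ^ Fintype.card F = x) : x ∈ Set.range (algebraMap F K) := by
  classical
  have hne : (X ^ Fintype.card F - X : K[X]) ≠ 0 :=
    FiniteField.X_pow_card_sub_X_ne_zero K Fintype.one_lt_card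
  have hsub : univ.image (algebraMap F K) ⊆ (X ^ Fintype.card F - X : K[X]).roots.toFinset := by
    intro z hz
    obtain ⟨a, -, rfl⟩ := mem_image.1 hz
    rw [Multiset.mem_toFinset, mem_roots hne]
    simp [← map_pow, FiniteField.pow_card]
  have heq := eq_of_subset_of_card_le hsub (by
    rw [card_image_of_injective _ (algebraMap F K).injective, card_univ]
    refine (Multiset.toFinset_card_le _).trans ((card_roots' _).trans ?_)
    rw [FiniteField.X_pow_card_sub_X_natDegree_eq K Fintype.one_lt_card])
  have : x ∈ univ.image (algebraMap F K) := by
    rw [heq, Multiset.mem_toFinset, mem_roots hne]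
    simp [hx]
  obtain ⟨a, -, ha⟩ := mem_image.1 this
  exact ⟨a, ha⟩

theorem mem_codeWithZeros_of_aeval {F K : Type*} [Field F] [Field K] [Algebra F K] {n : ℕ}
    {Z : Set K} {p : F[X]} (hn : p.natDegree < n) (hp : ∀ z ∈ Z, aeval z p = 0) :
    (fun i : Fin n => p.coeff i) ∈ codeWithZeros F n Z := by
  intro z hz
  rw [← hp z hz, aeval_eq_sum_range' hn, ← Fin.sum_univ_eq_sum_range
    (fun i => p.coeff i • z ^ i)]
  simp [Algebra.smul_def]

/-! ### The constacyclic MDS constituents. -/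

section OddMDSCode

variable {F K : Type*} [Field F] [Field K] [Algebra F K]

/-- The generator polynomial of `oddMDSCode q α b (2 * t + 1)`. -/
theorem exists_generator [Fintype F] {α : K} (hα : IsPrimitiveRoot α (Fintype.card F + 1))
    (b : F) (t : ℕ) :
    ∃ g : F[X], g.map (algebraMap F K) =
      ∏ j ∈ Icc (t + 1) (Fintype.card F - t), (X - C (algebraMap F K b * α ^ j)) := by
  set q := Fintype.card F with hq
  set G : K[X] := ∏ j ∈ Icc (t + 1) (q - t), (X - C (algebraMap F K b * α ^ j)) with hG
  have hα0 : α ≠ 0 := hα.ne_zero (by omega)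
  let φ : K →+* K := (FiniteField.frobeniusAlgHom F K : K →ₐ[F] K)
  have hφ : ∀ x, φ x = x ^ q := fun x => rfl
  have hmap : G.map φ = G := by
    rw [hG, Polynomial.map_prod]
    -- Since `α ^ q = α⁻¹`, Frobenius permutes the factors by this reflection of the interval.
    refine prod_nbij' (fun j => q + 1 - j) (fun j => q + 1 - j) ?_ ?_ ?_ ?_ ?_
    · intro j hj; rw [mem_Icc] at hj ⊢; omega
    · intro j hj; rw [mem_Icc] at hj ⊢; omega
    · intro j hj; rw [mem_Icc] at hj; omega
    · intro j hj; rw [mem_Icc] at hj; omega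
    · intro j hj
      rw [mem_Icc] at hj
      have h1 : (α ^ j) ^ q = α ^ (q + 1 - j) := by
        apply mul_right_cancel₀ (pow_ne_zero j hα0)
        rw [← pow_succ, ← pow_add, Nat.sub_add_cancel (by omega), ← pow_mul, mul_comm, pow_mul,
          hα.pow_eq_one, one_pow]
      rw [Polynomial.map_sub, map_X, map_C, hφ, mul_pow, ← map_pow, FiniteField.pow_card, h1]
  have hlift : G ∈ lifts (algebraMap F K) := by
    rw [lifts_iff_coeff_lifts]
    intro n
    refine mem_range_algebraMap_of_pow_card_eq ?_
    rw [← hq, ← hφ, ← coeff_map, hmap]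
  exact hlift

theorem oddMDSCode_hammingNorm [DecidableEq F] {q t : ℕ} {α : K}
    (hα : IsPrimitiveRoot α (q + 1)) (b : Fˣ) (ht : 2 * t + 1 ≤ q) {c : Fin (q + 1) → F}
    (hc : c ∈ oddMDSCode q α b (2 * t + 1)) (hc0 : c ≠ 0) :
    q + 2 - (2 * t + 1) ≤ hammingNorm c := by
  have := lt_hammingNorm_of_consecutive_zeros (s := q - 2 * t) (j₀ := t + 1)
    (β := algebraMap F K b) hα (hα.ne_zero (by omega)) (by simp) hc0
    (fun u hu => hc _ ⟨t + 1 + u, by omega, by omega, rfl⟩)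
  omega

theorem oddMDSCode_hasParams [Fintype F] {q t : ℕ} (hq : Fintype.card F = q) {α : K}
    (hα : IsPrimitiveRoot α (q + 1)) (b : Fˣ) (ht : 2 * t + 1 ≤ q) :
    HasParams (oddMDSCode q α b (2 * t + 1)) (q + 1) (2 * t + 1) (q + 2 - (2 * t + 1)) := by
  classical
  subst hq
  set q := Fintype.card F
  obtain ⟨g, hg⟩ := exists_generator hα (b : F) t
  have hdeg : g.natDegree = q - 2 * t := by
    rw [← natDegree_map (algebraMap F K), hg, natDegree_finsetProd_X_sub_C_eq_card, Nat.card_Icc]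
    omega
  have hg0 : g ≠ 0 := by
    rintro rfl
    simp at hdeg
    omega
  have hdist : ∀ c ∈ oddMDSCode q α b (2 * t + 1), c ≠ 0 → q + 2 - (2 * t + 1) ≤ hammingNorm c :=
    fun c hc hc0 => oddMDSCode_hammingNorm hα b ht hc hc0
  have hmem : ∀ p : F[X], (g * p).natDegree < q + 1 →
      (fun i : Fin (q + 1) => (g * p).coeff i) ∈ oddMDSCode q α b (2 * t + 1) := by
    intro p hp
    refine mem_codeWithZeros_of_aeval hp ?_
    rintro z ⟨j, hj1, hj2, rfl⟩
    rw [map_mul, ← aeval_map_algebraMap K _ g, hg, coe_aeval_eq_eval, eval_prod,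
      prod_eq_zero (i := j) (by rw [mem_Icc]; omega) (by simp), zero_mul]
  have hbound : ∀ p ∈ degreeLT F (2 * t + 1), (g * p).natDegree < q + 1 := by
    intro p hp
    by_cases hp0 : p = 0
    · simp [hp0]
    · rw [mem_degreeLT, ← natDegree_lt_iff_degree_lt hp0] at hp
      rw [natDegree_mul hg0 hp0]
      omega
  refine ⟨by simp, le_antisymm (finrank_le_of_hammingNorm (by omega) fun c hc hc0 => ?_) ?_,
    minDist_eq_of_hammingNorm hdist ?_⟩
  · exact hdist c hc hc0
  · let f : degreeLT F (2 * t + 1) →ₗ[F] oddMDSCode q α b (2 * t + 1) :=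
      { toFun := fun p => ⟨fun i => (g * p.1).coeff i, hmem p (hbound p p.2)⟩
        map_add' := fun p p' => by ext i; simp [mul_add]
        map_smul' := fun a p => by ext i; simp }
    have hf : Function.Injective f := by
      rw [← LinearMap.ker_eq_bot, LinearMap.ker_eq_bot']
      intro p hp
      have hz : g * p.1 = 0 := by
        ext i
        by_cases hi : i < q + 1
        · exact congrFun (congrArg Subtype.val hp) ⟨i, hi⟩
        · rw [coeff_zero]
          exact coeff_eq_zero_of_natDegree_lt ((hbound p p.2).trans_le (not_lt.1 hi))
      exact Subtype.ext ((mul_eq_zero.1 hz).resolve_left hg0)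
    have := LinearMap.finrank_le_finrank_of_injective hf
    rwa [(degreeLTEquiv F (2 * t + 1)).finrank_eq, Module.finrank_fin_fun] at this
  -- The generator itself is a word of minimum weight: it has at most `deg g + 1 = q + 1 - 2t`
  -- nonzero coefficients.
  · have hlt : (g * 1).natDegree < q + 1 := by rw [mul_one]; omega
    refine ⟨_, hmem 1 hlt, fun h0 => ?_, ?_⟩
    · have := congrFun h0 ⟨g.natDegree, by omega⟩
      simp [hg0] at this
    · calc hammingNorm (fun i : Fin (q + 1) => (g * 1).coeff i)
          ≤ #(range (g.natDegree + 1)) := by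
            refine card_le_card_of_injOn (fun i => (i : ℕ)) (fun i hi => ?_)
              (Fin.val_injective.injOn)
            have : g.coeff i ≠ 0 := by simpa using hi
            simpa [Nat.lt_succ_iff] using le_natDegree_of_ne_zero this
        _ ≤ q + 2 - (2 * t + 1) := by rw [card_range]; omega

theorem oddMDSCode_mono {q k k' : ℕ} (h : k ≤ k') (α : K) (b : Fˣ) :
    oddMDSCode q α b k ≤ oddMDSCode q α b k' := by
  rintro c hc z ⟨j, hj1, hj2, rfl⟩
  exact hc _ ⟨j, by omega, by omega, rfl⟩

end OddMDSCode

end LRC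

namespace LRC

open Finset

/-! ### Matrix-product codes of NSC matrices. -/

section MatrixProduct

variable {F : Type*} [Field F] {M N n : ℕ}

/-- The linear map sending `(c₁, …, c_M)` to the word `(c₁, …, c_M) · A`. -/
def matrixProductMap (A : Matrix (Fin M) (Fin N) F) :
    (Fin M → Fin n → F) →ₗ[F] (Fin N × Fin n → F) where
  toFun c p := ∑ l, c l p.2 * A l p.1
  map_add' c c' := by ext p; simp [add_mul, sum_add_distrib]
  map_smul' a c := by ext p; simp [mul_sum, mul_assoc]

/-- Were there `l + 1` columns where the combination vanishes, `u` restricted to the first `l + 1`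
rows would be a nonzero left kernel vector of a nonsingular submatrix. -/
theorem NSC.le_card_ne_zero [DecidableEq F] {A : Matrix (Fin M) (Fin N) F} (hA : NSC A)
    {u : Fin M → F} {l : Fin M} (hl : u l ≠ 0) (hu : ∀ l' > l, u l' = 0) :
    N - l ≤ #{j | ∑ l', u l' * A l' j ≠ 0} := by
  by_contra! hlt
  have hsum := card_filter_add_card_filter_not (s := (univ : Finset (Fin N)))
    (fun j => ∑ l', u l' * A l' j = 0)
  rw [card_univ, Fintype.card_fin] at hsum
  obtain ⟨T, hT, hTcard⟩ := exists_subset_card_eq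
    (s := univ.filter fun j => ∑ l', u l' * A l' j = 0) (n := (l : ℕ) + 1) (by
      simp only [ne_eq] at hlt
      omega)
  refine hA (l + 1) l.2 (T.orderEmbOfFin hTcard) (Matrix.exists_vecMul_eq_zero_iff.1
    ⟨u ∘ Fin.castLE l.2, fun h0 => hl ?_, ?_⟩)
  · exact congrFun h0 (Fin.last l)
  · ext j
    have hj := (mem_filter.1 (hT (T.orderEmbOfFin_mem hTcard j))).2
    rw [Pi.zero_apply, ← hj]
    refine Fintype.sum_of_injective (Fin.castLE l.2) (Fin.castLE_injective _) _ _ ?_ ?_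
    · intro i hi
      rw [hu i, zero_mul]
      by_contra hle
      exact hi ⟨⟨i, Nat.lt_succ_of_le (not_lt.1 hle)⟩, rfl⟩
    · intro i
      rfl

theorem NSC.mul_hammingNorm_le [DecidableEq F] {A : Matrix (Fin M) (Fin N) F} (hA : NSC A)
    {c : Fin M → Fin n → F} {l : Fin M} (hc : ∀ l' > l, c l' = 0) :
    (N - l) * hammingNorm (c l) ≤ hammingNorm (matrixProductMap A c) := by
  calc (N - l) * hammingNorm (c l)
      = ∑ i ∈ univ.filter (fun i => c l i ≠ 0), (N - l) := by
        rw [sum_const, smul_eq_mul, mul_comm]; rfl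
    _ ≤ ∑ i ∈ univ.filter (fun i => c l i ≠ 0), #{j | ∑ l', c l' i * A l' j ≠ 0} :=
        sum_le_sum fun i hi => hA.le_card_ne_zero (u := fun l' => c l' i) (mem_filter.1 hi).2
          fun l' hl' => by simp [hc l' hl']
    _ ≤ ∑ i, #{j | ∑ l', c l' i * A l' j ≠ 0} :=
        sum_le_sum_of_subset (filter_subset _ _)
    _ = hammingNorm (matrixProductMap A c) := by
        simp only [hammingNorm, card_filter, Fintype.sum_prod_type_right]
        rfl

theorem exists_last_ne_zero {ι V : Type*} [Fintype ι] [LinearOrder ι] [Zero V] {c : ι → V}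
    (hc : c ≠ 0) : ∃ l, c l ≠ 0 ∧ ∀ l' > l, c l' = 0 := by
  classical
  obtain ⟨i, hi⟩ := Function.ne_iff.1 hc
  obtain ⟨l, hl, hmax⟩ := exists_max_image (univ.filter fun l => c l ≠ 0) id
    ⟨i, by simpa using hi⟩
  refine ⟨l, (mem_filter.1 hl).2, fun l' hl' => ?_⟩
  by_contra h0
  exact (hmax l' (by simpa using h0)).not_gt hl'

/-- The weight bound is positive for nonzero `c`, because `l < M ≤ N`. -/
theorem NSC.matrixProductMap_injective {A : Matrix (Fin M) (Fin N) F} (hA : NSC A) (hMN : M ≤ N) :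
    Function.Injective (matrixProductMap (n := n) A) := by
  classical
  rw [← LinearMap.ker_eq_bot, LinearMap.ker_eq_bot']
  intro c hc
  by_contra hc0
  obtain ⟨l, hl, hl'⟩ := exists_last_ne_zero hc0
  have h := hA.mul_hammingNorm_le hl'
  rw [hc, hammingNorm_zero, Nat.le_zero, mul_eq_zero, hammingNorm_eq_zero] at h
  rcases h with h | h
  · have := l.2
    omega
  · exact hl h

theorem NSC.finrank_matrixProductCode {A : Matrix (Fin M) (Fin N) F} (hA : NSC A) (hMN : M ≤ N)
    (C : Fin M → Submodule F (Fin n → F)) :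
    Module.finrank F (matrixProductCode C A) = ∑ l, Module.finrank F (C l) := by
  let f : (∀ l, C l) →ₗ[F] (Fin N × Fin n → F) :=
    (matrixProductMap A).comp (LinearMap.piMap fun l => (C l).subtype)
  have hf : Function.Injective f := by
    refine (hA.matrixProductMap_injective hMN).comp fun c c' h => ?_
    ext l i
    exact congrFun (congrFun h l) i
  have hr : matrixProductCode C A = LinearMap.range f := by
    ext x
    constructor
    · rintro ⟨c, hc, rfl⟩
      exact ⟨fun l => ⟨c l, hc l⟩, rfl⟩
    · rintro ⟨c, rfl⟩
      exact ⟨fun l => c l, fun l => (c l).2, rfl⟩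
  rw [hr, LinearMap.finrank_range_of_inj hf, Module.finrank_pi_fintype]

theorem NSC.le_hammingNorm_of_mem [DecidableEq F] {A : Matrix (Fin M) (Fin N) F} (hA : NSC A)
    {C : Fin M → Submodule F (Fin n → F)} {d : ℕ}
    (hd : ∀ l, ∀ c ∈ C l, c ≠ 0 → d ≤ (N - l) * hammingNorm c)
    {x : Fin N × Fin n → F} (hx : x ∈ matrixProductCode C A) (hx0 : x ≠ 0) :
    d ≤ hammingNorm x := by
  obtain ⟨c, hc, rfl⟩ := hx
  have hc0 : c ≠ 0 := by
    rintro rfl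
    exact hx0 (by ext p; simp)
  obtain ⟨l, hl, hl'⟩ := exists_last_ne_zero hc0
  exact (hd l (c l) (hc l) hl).trans (hA.mul_hammingNorm_le hl')

/-- A nontrivial combination of the rows vanishes on the first `M - 1` columns; multiplied by a
common word of the constituents, it gives a word of small weight. -/
theorem NSC.exists_hammingNorm_le [DecidableEq F] {A : Matrix (Fin M) (Fin N) F} (hA : NSC A)
    (hM : 0 < M) (hMN : M ≤ N) {C : Fin M → Submodule F (Fin n → F)} {c : Fin n → F}
    (hc : ∀ l, c ∈ C l) (hc0 : c ≠ 0) :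
    ∃ x ∈ matrixProductCode C A, x ≠ 0 ∧ hammingNorm x ≤ (N - M + 1) * n := by
  have hle : M - 1 ≤ N := by omega
  obtain ⟨u, hu, hu0⟩ := (Submodule.ne_bot_iff _).1 (LinearMap.ker_ne_bot_of_finrank_lt
    (f := (A.submatrix id (Fin.castLE hle)).vecMulLinear) (by simpa using hM))
  refine ⟨matrixProductMap A fun l => u l • c, ⟨_, fun l => (C l).smul_mem _ (hc l), rfl⟩, ?_, ?_⟩
  · rw [(map_ne_zero_iff _ (hA.matrixProductMap_injective hMN))]
    obtain ⟨l, hl⟩ := Function.ne_iff.1 hu0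
    exact Function.ne_iff.2 ⟨l, smul_ne_zero hl hc0⟩
  · calc hammingNorm (matrixProductMap A fun l => u l • c)
        ≤ #((univ.image (Fin.castLE hle))ᶜ ×ˢ (univ : Finset (Fin n))) := by
          refine card_le_card fun p hp => ?_
          simp only [mem_filter, mem_univ, true_and, mem_product, mem_compl, mem_image, not_exists,
            and_true] at hp ⊢
          intro j hj
          apply hp
          have h := congrFun hu j
          calc ∑ l, u l * c p.2 * A l p.1 = c p.2 * ∑ l, u l * A l (Fin.castLE hle j) := by
                rw [mul_sum, hj]
                exact sum_congr rfl fun l _ => by ring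
            _ = c p.2 * 0 := congrArg _ h
            _ = 0 := mul_zero _
      _ = (N - M + 1) * n := by
          rw [card_product, card_compl, card_image_of_injective _ (Fin.castLE_injective hle)]
          simp only [Fintype.card_fin, card_univ]
          congr 1
          omega

/-- The blocks of a matrix-product code are repair sets. -/
theorem isLRC_matrixProductCode {C : Fin M → Submodule F (Fin n → F)} {D : Submodule F (Fin n → F)}
    (hCD : ∀ l, C l ≤ D) {r δ : ℕ} (hn : n ≤ r + δ - 1) (hD : (δ : ℕ∞) ≤ minDist D)
    (A : Matrix (Fin M) (Fin N) F) : IsLRC (matrixProductCode C A) r δ := by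
  classical
  rintro ⟨j, i⟩
  refine ⟨{j} ×ˢ univ, by simp, by simpa using hn, ?_⟩
  rw [le_minDist_iff] at hD ⊢
  rintro _ ⟨_, ⟨c, hc, rfl⟩, rfl⟩ hx0
  set y : Fin n → F := ∑ l, A l j • c l with hy
  have hyD : y ∈ D := D.sum_mem fun l _ => D.smul_mem _ (hCD l (hc l))
  have hyx : ∀ p : ({j} ×ˢ univ : Finset (Fin N × Fin n)),
      LinearMap.funLeft F F Subtype.val (fun p : Fin N × Fin n => ∑ l, c l p.2 * A l p.1) p
        = y p.1.2 := by
    rintro ⟨⟨j', i⟩, hp⟩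
    obtain rfl : j = j' := by simpa [eq_comm] using hp
    simp [hy, LinearMap.funLeft_apply, mul_comm]
  have hy0 : y ≠ 0 := by
    intro h0
    exact hx0 (funext fun p => by rw [hyx, h0]; rfl)
  refine (hD y hyD hy0).trans ?_
  refine card_le_card_of_injOn (fun i => ⟨(j, i), by simp⟩) (fun i hi => ?_) ?_
  · simp only [coe_filter, mem_univ, true_and, Set.mem_ofPred_eq] at hi ⊢
    rwa [hyx]
  · intro i _ i' _ h
    simpa using h

end MatrixProduct

/-! ### Vandermonde matrices, optimality and the final parameters. -/

/-- A Vandermonde matrix on distinct nodes is nonsingular by columns. -/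
theorem NSC_vandermonde {F : Type*} [Field F] {M N : ℕ} {v : Fin N → F}
    (hv : Function.Injective v) : NSC (Matrix.of fun (l : Fin M) j => v j ^ (l : ℕ)) := by
  intro i hi J
  have h : (Matrix.of fun (l : Fin M) j => v j ^ (l : ℕ)).submatrix (Fin.castLE hi) J
      = (Matrix.vandermonde (v ∘ J)).transpose := by
    ext l j
    simp [Matrix.vandermonde]
  rw [h, Matrix.det_transpose, Matrix.det_vandermonde_ne_zero_iff]
  exact hv.comp J.injective

theorem IsLRC.isOptimalLRC {F ι : Type*} [Field F] [Fintype ι] {C : Submodule F (ι → F)}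
    {M N q r : ℕ} (hM : 0 < M) (hMN : M ≤ N) (hr : 0 < r) (hrq : r ≤ q)
    (hC : IsLRC C r (q + 2 - r))
    (hp : HasParams C (N * (q + 1)) ((M - 1) * r + 1) ((N - M + 1) * (q + 1))) :
    IsOptimalLRC C r (q + 2 - r) := by
  refine ⟨hC, _, _, _, hp, ?_⟩
  have hr' : (0 : ℚ) < r := by exact_mod_cast hr
  -- The summand 1 from the one-dimensional last constituent pushes the quotient just past `M - 1`.
  have hceil : ⌈(((M - 1) * r + 1 : ℕ) : ℚ) / (r : ℚ)⌉ = M := by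
    rw [Int.ceil_eq_iff, lt_div_iff₀ hr', div_le_iff₀ hr']
    have h1 : (1 : ℚ) ≤ r := by exact_mod_cast hr
    push_cast [Nat.cast_sub (show 1 ≤ M from hM)]
    constructor <;> nlinarith
  rw [hceil]
  push_cast [Nat.cast_sub hMN, Nat.cast_sub (show 1 ≤ M from hM),
    Nat.cast_sub (show r ≤ q + 2 by omega)]
  ring

theorem matrixProductCode_oddMDSCode {F K : Type*} [Field F] [Fintype F] [Field K] [Algebra F K]
    {q : ℕ} (hq : Fintype.card F = q) {α : K} (hα : IsPrimitiveRoot α (q + 1)) (b : Fˣ)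
    {M N t : ℕ} {A : Matrix (Fin M) (Fin N) F} (hA : NSC A) (hM : 1 < M) (hMN : M ≤ N)
    (ht : 2 * t + 1 ≤ q) (h : 2 * t * (N - M + 1) + (2 * t + 1) ≤ q + 2) :
    IsOptimalLRC
        (matrixProductCode (constituents M (oddMDSCode q α b (2 * t + 1)) (oddMDSCode q α b 1)) A)
        (2 * t + 1) (q + 2 - (2 * t + 1)) ∧
      HasParams
        (matrixProductCode (constituents M (oddMDSCode q α b (2 * t + 1)) (oddMDSCode q α b 1)) A)
        (N * (q + 1)) ((M - 1) * (2 * t + 1) + 1) ((N - M + 1) * (q + 1)) := by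
  classical
  obtain ⟨-, hdim, hdist⟩ := oddMDSCode_hasParams hq hα b ht
  obtain ⟨-, hdim₁, hdist₁⟩ := oddMDSCode_hasParams (t := 0) hq hα b (by omega)
  simp only [mul_zero, zero_add] at hdim₁ hdist₁
  set D := oddMDSCode q α b (2 * t + 1)
  set E := oddMDSCode q α b 1
  have hED : E ≤ D := oddMDSCode_mono (by omega) α b
  have hconst : ∀ l, constituents M D E l ≤ D := by
    intro l
    unfold constituents
    split_ifs
    exacts [le_rfl, hED]
  have hconst' : ∀ l, E ≤ constituents M D E l := by
    intro l
    unfold constituents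
    split_ifs
    exacts [hED, le_rfl]
  suffices hp : HasParams (matrixProductCode (constituents M D E) A) (N * (q + 1))
      ((M - 1) * (2 * t + 1) + 1) ((N - M + 1) * (q + 1)) from
    ⟨(isLRC_matrixProductCode hconst (by omega) hdist.ge A).isOptimalLRC (by omega) hMN
      (by omega) ht hp, hp⟩
  refine ⟨by simp, ?_, ?_⟩
  · rw [hA.finrank_matrixProductCode hMN]
    obtain ⟨m, rfl⟩ : ∃ m, M = m + 1 := ⟨M - 1, by omega⟩
    rw [Fin.sum_univ_castSucc]
    have hinit : ∀ i : Fin m,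
        Module.finrank F (constituents (m + 1) D E i.castSucc) = 2 * t + 1 := fun i => by
      rw [show constituents (m + 1) D E i.castSucc = D by simp [constituents], hdim]
    have hlast : Module.finrank F (constituents (m + 1) D E (Fin.last m)) = 1 := by
      rw [show constituents (m + 1) D E (Fin.last m) = E by simp [constituents], hdim₁]
    rw [hlast, sum_congr rfl fun i _ => hinit i]
    simp
  · refine minDist_eq_of_hammingNorm (fun x hx hx0 => hA.le_hammingNorm_of_mem ?_ hx hx0) ?_
    · intro l c hc hc0
      unfold constituents at hc
      split_ifs at hc with hl
      · have hw := (le_minDist_iff _ _).1 hdist.ge c hc hc0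
        -- With `s = N - M` and `d = q + 2 - r`, this is equivalent to `2t(s + 1) ≤ d`, the
        -- numerical hypothesis; here `l ≤ M - 2`.
        calc (N - M + 1) * (q + 1) ≤ (N - M + 2) * (q + 2 - (2 * t + 1)) := by
              generalize N - M = s at h
              obtain ⟨d, hd⟩ : ∃ d, q + 2 - (2 * t + 1) = d := ⟨_, rfl⟩
              obtain rfl : q = d + 2 * t - 1 := by omega
              rw [hd, show d + 2 * t - 1 + 1 = d + 2 * t by omega]
              have : 2 * t * (s + 1) ≤ d := by omega
              nlinarith
          _ ≤ (N - l) * hammingNorm c := Nat.mul_le_mul (by omega) hw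
      · have hw := (le_minDist_iff _ _).1 hdist₁.ge c hc hc0
        have := l.2
        exact Nat.mul_le_mul (by omega) (by omega)
    · have hE : E ≠ ⊥ := by
        intro h0
        rw [h0, finrank_bot] at hdim₁
        omega
      obtain ⟨c, hc, hc0⟩ := (Submodule.ne_bot_iff _).1 hE
      exact hA.exists_hammingNorm_le (by omega) hMN (fun l => hconst' l hc) hc0

end LRC

theorem corollary2 {F K : Type*} [Field F] [Finite F] [Field K] [Algebra F K]
    (q : ℕ) (hq : Nat.card F = q) (α : K) (hα : IsPrimitiveRoot α (q + 1)) (b : Fˣ) :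
    (∀ (M N r : ℕ) (A : Matrix (Fin M) (Fin N) F),
      1 < M → M < N → N ≤ q → LRC.NSC A → Odd r → (r - 1) * (N - M + 1) + r ≤ q + 2 →
        LRC.HasParams (LRC.oddMDSCode q α b r) (q + 1) r (q + 2 - r) ∧
        LRC.HasParams (LRC.oddMDSCode q α b 1) (q + 1) 1 (q + 1) ∧
        LRC.oddMDSCode q α b 1 ≤ LRC.oddMDSCode q α b r ∧
        LRC.IsOptimalLRC
          (LRC.matrixProductCode
            (LRC.constituents M (LRC.oddMDSCode q α b r) (LRC.oddMDSCode q α b 1)) A)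
          r (q + 2 - r) ∧
        LRC.HasParams
          (LRC.matrixProductCode
            (LRC.constituents M (LRC.oddMDSCode q α b r) (LRC.oddMDSCode q α b 1)) A)
          (N * (q + 1)) ((M - 1) * r + 1) ((N - M + 1) * (q + 1)) ∧
        N * (q + 1) ≤ q ^ 2 + q) ∧
    (∀ M r : ℕ, 1 < M → M < q → Odd r → (r - 1) * (q - M + 1) + r ≤ q + 2 →
      ∃ A : Matrix (Fin M) (Fin q) F, LRC.NSC A ∧
        LRC.IsOptimalLRC
          (LRC.matrixProductCode
            (LRC.constituents M (LRC.oddMDSCode q α b r) (LRC.oddMDSCode q α b 1)) A)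
          r (q + 2 - r) ∧
        LRC.HasParams
          (LRC.matrixProductCode
            (LRC.constituents M (LRC.oddMDSCode q α b r) (LRC.oddMDSCode q α b 1)) A)
          (q ^ 2 + q) ((M - 1) * r + 1) ((q - M + 1) * (q + 1))) := by
  have := Fintype.ofFinite F
  rw [Nat.card_eq_fintype_card] at hq
  -- The bound `r ≤ q` follows from `N - M + 1 ≥ 2`, which turns the hypothesis into `6t + 1 ≤ q +
  -- 2`.
  have two_mul_add_one_le : ∀ {N M t : ℕ}, M < N →
      2 * t * (N - M + 1) + (2 * t + 1) ≤ q + 2 → 2 * t + 1 ≤ q := fun {N M t} hMN h => by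
    have hs : 2 * t * 2 ≤ 2 * t * (N - M + 1) := Nat.mul_le_mul_left _ (by omega)
    have hq1 : 1 < Fintype.card F := Fintype.one_lt_card
    omega
  refine ⟨fun M N r A hM hMN hN hA hr h => ?_, fun M r hM hMq hr h => ?_⟩
  · obtain ⟨t, rfl⟩ := hr
    rw [Nat.add_sub_cancel] at h
    have ht := two_mul_add_one_le hMN h
    obtain ⟨hopt, hp⟩ := LRC.matrixProductCode_oddMDSCode hq hα b hA hM hMN.le ht h
    exact ⟨LRC.oddMDSCode_hasParams hq hα b ht,
      LRC.oddMDSCode_hasParams (t := 0) hq hα b (by omega),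
      LRC.oddMDSCode_mono (by omega) α b, hopt, hp, by nlinarith⟩
  · obtain ⟨t, rfl⟩ := hr
    rw [Nat.add_sub_cancel] at h
    have hA := LRC.NSC_vandermonde (M := M) (Fintype.equivFinOfCardEq hq).symm.injective
    obtain ⟨hopt, hp⟩ := LRC.matrixProductCode_oddMDSCode hq hα b hA hM hMq.le
      (two_mul_add_one_le hMq h) h
    rw [mul_add_one, ← sq] at hp
    exact ⟨_, hA, hopt, hp⟩
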